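/- Let $X$ be a compact Hausdorff space and let $h \colon X \to X$ be a homeomorphism. Let $C^*(\mathbb{Z}, X, h)$ be the crossed product of $C(X)$ by the automorphism $f \mapsto f \circ h^{-1}$. Identify $C(X)$ with its standard image in $C^*(\mathbb{Z}, X, h)$, let $u \in C^*(\mathbb{Z}, X, h)$ be the standard unitary, so that $u f u^* = f \circ h^{-1}$ for $f \in C(X)$, and let $E \colon C^*(\mathbb{Z}, X, h) \to C(X)$ be the usual conditional expectation, so that $E \big( \sum_{n = -m}^{m} f_n u^n \big) = f_0$ for $f_{-m}, \ldots, f_m \in C(X)$. For a closed subset $Y \subset X$ let $C_0 (X \setminus Y)$ be the set of those $f \in C(X)$ which vanish on $Y$, and, if $Y \neq \varnothing$, let \[ C^*(\mathbb{Z}, X, h)_Y = C^* \big( C(X), \, C_0 (X \setminus Y) u \big) \subset C^*(\mathbb{Z}, X, h) \] be the $Y$-orbit breaking subalgebra. Let $Z \subset Y \subset X$ be nonempty closed subsets, let $N$ be a positive integer, and suppose that $h^N (Z) \subset Y$. Index the entries of $N \times N$ matrices by $\{0, 1, \ldots, N - 1\}$. Let $w \in M_N \subset M_N (C(Z))$ be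 the matrix with $w_{j + 1, j} = 1$ for $0 \leq j \leq N - 2$ and all other entries $0$. Then there exists a unique unital $*$-homomorphism $\gamma_{N, Z} \colon C^*(\mathbb{Z}, X, h)_Y \to M_N (C(Z))$ such that for all $f \in C(X)$ \[ \gamma_{N, Z} (f) = \operatorname{diag} \big( f|_Z, \, (f \circ h)|_Z, \, \ldots, \, (f \circ h^{N - 1})|_Z \big) \] and for all $f \in C_0 (X \setminus Y)$ \[ \gamma_{N, Z} (f u) = \operatorname{diag} \big( f|_Z, \, (f \circ h)|_Z, \, \ldots, \, (f \circ h^{N - 1})|_Z \big) \, w . \] Moreover, for every $a \in C^*(\mathbb{Z}, X, h)_Y$, \[ \gamma_{N, Z} (a) = \sum_{n = 0}^{N} \gamma_{N, Z} \big( E (a u^{-n}) \big) w^n + \sum_{n = -N}^{-1} \gamma_{N, Z} \big( E (a u^{-n}) \big) (w^*)^{-n}, \] and, if $a_n = E (a u^{-n})$ for $n \in \mathbb{Z}$ (so that $a$ has the formal series $\sum_{n = -\infty}^{\infty} a_n u^n$), then \[ \gamma_{N, Z} (a) (x)_{j, k} = a_{j - k} (h^j (x)) \] for all $x \in Z$ and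 $j, k \in \{0, 1, \ldots, N - 1\}$. -/

import Mathlib

open scoped ENNReal

noncomputable section

namespace OrbitBreaking

universe u

/-! ### The crossed product `C*(ℤ, X, h)` -/

/-- A (nondegenerate) covariant representation, on a nonzero Hilbert space, of the action of `ℤ`
on `C(X)` generated by `f ↦ f ∘ h⁻¹`: a unital `*`-representation `π` of `C(X)` and a unitary `U`
with `U π(f) U* = π(f ∘ h⁻¹)`. -/
structure CovariantRep {X : Type u} [TopologicalSpace X] (h : X ≃ₜ X) where
  /-- The Hilbert space of the representation. -/
  H : Type u
  [normed : NormedAddCommGroup H]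
  [inner : InnerProductSpace ℂ H]
  [complete : CompleteSpace H]
  [nontrivial : Nontrivial H]
  /-- The representation of `C(X)`. -/
  π : C(X, ℂ) →⋆ₐ[ℂ] (H →L[ℂ] H)
  /-- The unitary which implements the homeomorphism. -/
  U : unitary (H →L[ℂ] H)
  covariant : ∀ f : C(X, ℂ),
    (U : H →L[ℂ] H) * π f * star (U : H →L[ℂ] H) = π (f.comp (h.symm : C(X, X)))

attribute [instance] CovariantRep.normed CovariantRep.inner CovariantRep.complete
  CovariantRep.nontrivial

variable {X : Type u} [TopologicalSpace X]

/-- The C*-algebra of all bounded families of operators, one for each covariant representation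
(on a Hilbert space in the universe of `X`; this universe is large enough to contain, up to
unitary equivalence, all cyclic covariant representations). -/
abbrev ProductAlgebra (h : X ≃ₜ X) : Type (u + 1) :=
  lp (fun ρ : CovariantRep h => ρ.H →L[ℂ] ρ.H) ∞

instance (h : X ≃ₜ X) : CStarAlgebra (ProductAlgebra h) where

theorem memlp_of_norm_le (h : X ≃ₜ X) (a : ∀ ρ : CovariantRep h, ρ.H →L[ℂ] ρ.H) (C : ℝ)
    (ha : ∀ ρ, ‖a ρ‖ ≤ C) : Memℓp a ∞ := by
  refine memℓp_infty ⟨C, ?_⟩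
  rintro _ ⟨ρ, rfl⟩
  exact ha ρ

/-- The direct sum of the unitaries of all covariant representations. -/
def universalUnitary (h : X ≃ₜ X) : ProductAlgebra h :=
  ⟨fun ρ => (ρ.U : ρ.H →L[ℂ] ρ.H), memlp_of_norm_le h _ 1 fun ρ =>
    (CStarRing.norm_coe_unitary ρ.U).le⟩

variable [CompactSpace X]

/-- The direct sum of the representations of `C(X)` over all covariant representations. -/
def universalRep (h : X ≃ₜ X) : C(X, ℂ) →⋆ₐ[ℂ] ProductAlgebra h where
  toFun f := ⟨fun ρ => ρ.π f, memlp_of_norm_le h _ ‖f‖ fun ρ =>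
    NonUnitalStarAlgHom.norm_apply_le ρ.π f⟩
  map_one' := by ext1; funext ρ; exact map_one ρ.π
  map_mul' f g := by ext1; funext ρ; exact map_mul ρ.π f g
  map_zero' := by ext1; funext ρ; exact map_zero ρ.π
  map_add' f g := by ext1; funext ρ; exact map_add ρ.π f g
  commutes' c := by ext1; funext ρ; exact AlgHomClass.commutes ρ.π c
  map_star' f := by ext1; funext ρ; exact map_star ρ.π f

/-- The (full) crossed product `C*(ℤ, X, h)`: the norm closed `*`-subalgebra generated by `C(X)`
and the standard unitary inside the direct sum of all covariant representations. -/
def crossedProduct (h : X ≃ₜ X) : StarSubalgebra ℂ (ProductAlgebra h) :=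
  (StarAlgebra.adjoin ℂ
    (Set.range (universalRep h) ∪ {universalUnitary h})).topologicalClosure

instance (h : X ≃ₜ X) : IsClosed (crossedProduct h : Set (ProductAlgebra h)) :=
  StarSubalgebra.isClosed_topologicalClosure _

instance (h : X ≃ₜ X) : CStarAlgebra (crossedProduct h) := StarSubalgebra.cstarAlgebra _

/-- The standard embedding of `C(X)` in `C*(ℤ, X, h)`. -/
def funIncl (h : X ≃ₜ X) : C(X, ℂ) →⋆ₐ[ℂ] crossedProduct h :=
  (universalRep h).codRestrict (crossedProduct h) fun f =>
    StarSubalgebra.le_topologicalClosure _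
      (StarAlgebra.subset_adjoin ℂ _ (Or.inl ⟨f, rfl⟩))

/-- The standard unitary `u` of `C*(ℤ, X, h)`. -/
def stdUnitary (h : X ≃ₜ X) : unitary (crossedProduct h) :=
  ⟨⟨universalUnitary h, StarSubalgebra.le_topologicalClosure _
      (StarAlgebra.subset_adjoin ℂ _ (Or.inr rfl))⟩, by
    rw [Unitary.mem_iff]
    constructor
    · apply Subtype.ext; ext1; funext ρ; exact Unitary.coe_star_mul_self ρ.U
    · apply Subtype.ext; ext1; funext ρ; exact Unitary.coe_mul_star_self ρ.U⟩

/-- `u f u* = f ∘ h⁻¹`. -/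
theorem stdUnitary_conj (h : X ≃ₜ X) (f : C(X, ℂ)) :
    (stdUnitary h : crossedProduct h) * funIncl h f * star (stdUnitary h : crossedProduct h) =
      funIncl h (f.comp (h.symm : C(X, X))) := by
  apply Subtype.ext; ext1; funext ρ; exact ρ.covariant f

/-! ### The regular representation and the conditional expectation -/

/-- The operator `δ_i ↦ f (p i) δ_i` on `ℓ²(ι)`. -/
def diagOp {ι : Type u} (p : ι → X) (f : C(X, ℂ)) :
    lp (fun _ : ι => ℂ) 2 →L[ℂ] lp (fun _ : ι => ℂ) 2 :=
  LinearMap.mkContinuous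
    { toFun := fun v => ⟨fun i => f (p i) * v i, by
        refine memℓp_gen (Summable.of_nonneg_of_le (fun i => by positivity) (fun i => ?_)
          (((lp.memℓp ((‖f‖ : ℂ) • v)).summable (p := 2) (by norm_num))))
        rw [lp.coeFn_smul, Pi.smul_apply, smul_eq_mul, norm_mul, norm_mul, Complex.norm_real,
          norm_norm]
        gcongr
        exact f.norm_coe_le_norm _⟩
      map_add' := fun v w => by ext1; funext i; exact mul_add _ _ _
      map_smul' := fun c v => by ext1; funext i; exact mul_left_comm _ _ _ }
    ‖f‖ fun v => by
      have : ‖(‖f‖ : ℂ) • v‖ = ‖f‖ * ‖v‖ := by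
        rw [norm_smul, Complex.norm_real, norm_norm]
      rw [← this]
      refine lp.norm_mono (by norm_num) fun i => ?_
      change ‖f (p i) * v i‖ ≤ ‖(‖f‖ : ℂ) * v i‖
      rw [norm_mul, norm_mul, Complex.norm_real, norm_norm]
      gcongr
      exact f.norm_coe_le_norm _

theorem diagOp_apply {ι : Type u} (p : ι → X) (f : C(X, ℂ)) (v : lp (fun _ : ι => ℂ) 2) (i : ι) :
    diagOp p f v i = f (p i) * v i := rfl

/-- The operator `δ_i ↦ δ_{σ(i)}` on `ℓ²(ι)`. -/
def permOp {ι : Type u} (σ : Equiv.Perm ι) :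
    lp (fun _ : ι => ℂ) 2 →L[ℂ] lp (fun _ : ι => ℂ) 2 :=
  LinearMap.mkContinuous
    { toFun := fun v => ⟨fun i => v (σ.symm i), memℓp_gen
        ((σ.symm.summable_iff (f := fun i => ‖v i‖ ^ (2 : ℝ≥0∞).toReal)).2
          ((lp.memℓp v).summable (by norm_num)))⟩
      map_add' := fun v w => by ext1; funext i; rfl
      map_smul' := fun c v => by ext1; funext i; rfl }
    1 fun v => by
      rw [one_mul, lp.norm_eq_tsum_rpow (by norm_num), lp.norm_eq_tsum_rpow (by norm_num)]
      exact le_of_eq (congrArg (· ^ _)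
        (σ.symm.tsum_eq (fun i => ‖v i‖ ^ (2 : ℝ≥0∞).toReal)))

theorem permOp_apply {ι : Type u} (σ : Equiv.Perm ι) (v : lp (fun _ : ι => ℂ) 2) (i : ι) :
    permOp σ v i = v (σ.symm i) := rfl

theorem star_diagOp {ι : Type u} (p : ι → X) (f : C(X, ℂ)) :
    star (diagOp p f) = diagOp p (star f) := by
  rw [ContinuousLinearMap.star_eq_adjoint, eq_comm, ContinuousLinearMap.eq_adjoint_iff]
  intro v w
  rw [lp.inner_eq_tsum, lp.inner_eq_tsum]
  refine tsum_congr fun i => ?_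
  rw [diagOp_apply, diagOp_apply]
  simp only [RCLike.inner_apply, ContinuousMap.star_apply, map_mul, RCLike.star_def,
    RCLike.conj_conj]
  ring

theorem star_permOp {ι : Type u} (σ : Equiv.Perm ι) :
    star (permOp σ) = permOp σ.symm := by
  rw [ContinuousLinearMap.star_eq_adjoint, eq_comm, ContinuousLinearMap.eq_adjoint_iff]
  intro v w
  rw [lp.inner_eq_tsum, lp.inner_eq_tsum, ← σ.symm.tsum_eq]
  refine tsum_congr fun i => ?_
  rw [permOp_apply, permOp_apply]
  simp

open Classical in
/-- The standard basis vector `δ_i` of `ℓ²(ι)`. -/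
def basisVec {ι : Type u} (i : ι) : lp (fun _ : ι => ℂ) 2 := lp.single 2 i 1

theorem basisVec_self {ι : Type u} (i : ι) : basisVec i i = 1 := by simp [basisVec]

theorem basisVec_ne {ι : Type u} {i j : ι} (hij : j ≠ i) : basisVec i j = 0 := by
  simp [basisVec, hij]

theorem norm_basisVec {ι : Type u} (i : ι) : ‖basisVec i‖ = 1 := by
  classical
  unfold basisVec
  rw [lp.norm_single (by norm_num), norm_one]

/-- The regular representation, on `ℓ²(ℤ × X)` with `X` as a discrete set (the representation
induced from the faithful representation of `C(X)` on `ℓ²(X)` by multiplication):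
`f δ_{(n, x)} = f (hⁿ(x)) δ_{(n, x)}` and `u δ_{(n, x)} = δ_{(n + 1, x)}`. -/
def regularRep [Nonempty X] (h : X ≃ₜ X) : CovariantRep h where
  H := lp (fun _ : ℤ × X => ℂ) 2
  nontrivial := by
    obtain ⟨x⟩ := ‹Nonempty X›
    refine ⟨basisVec ((0 : ℤ), x), 0, fun H => ?_⟩
    have := congrArg (fun v : lp (fun _ : ℤ × X => ℂ) 2 => v (0, x)) H
    simp [basisVec] at this
  π :=
    { toFun := diagOp fun i : ℤ × X => (h ^ i.1) i.2
      map_one' := by ext v i; simp [diagOp_apply]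
      map_mul' := fun f g => by ext v i; simp [diagOp_apply, mul_assoc]
      map_zero' := by ext v i; simp [diagOp_apply]
      map_add' := fun f g => by ext v i; simp [diagOp_apply, add_mul]
      commutes' := fun c => by
        ext v i; simp [diagOp_apply, Algebra.algebraMap_eq_smul_one]
      map_star' := fun f => (star_diagOp _ f).symm }
  U := ⟨permOp ((Equiv.addRight (1 : ℤ)).prodCongr (Equiv.refl X)), by
    rw [Unitary.mem_iff, star_permOp]
    constructor <;> ext v i <;> simp [permOp_apply, Prod.map]⟩
  covariant f := by
    change permOp _ * diagOp _ f * star (permOp _) = diagOp _ _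
    rw [star_permOp]
    ext v i
    have key : (h ^ (i.1 + -1)) i.2 = h.symm ((h ^ i.1) i.2) := by
      rw [add_comm, zpow_add, zpow_neg_one]; rfl
    simp [permOp_apply, diagOp_apply, Prod.map, key]

/-- The image of an element in the regular representation. -/
def regularOp [Nonempty X] (h : X ≃ₜ X) (a : ProductAlgebra h) :
    lp (fun _ : ℤ × X => ℂ) 2 →L[ℂ] lp (fun _ : ℤ × X => ℂ) 2 :=
  a (regularRep h)

theorem basisVec_zero_apply {S : Type u} (x : S) (n : ℤ) :
    basisVec ((0 : ℤ), x) (n, x) = if n = 0 then 1 else 0 := by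
  by_cases hn : n = 0
  · subst hn; simp [basisVec_self]
  · rw [if_neg hn, basisVec_ne (fun H => hn (congrArg Prod.fst H))]

theorem continuous_regular_of_mem_adjoin [Nonempty X] (h : X ≃ₜ X) (a : ProductAlgebra h)
    (ha : a ∈ StarAlgebra.adjoin ℂ (Set.range (universalRep h) ∪ {universalUnitary h})) (n : ℤ) :
    Continuous fun x : X => regularOp h a (basisVec (0, x)) (n, x) := by
  have ha' : a ∈ Submodule.span ℂ
      (Submonoid.closure (Set.range (universalRep h) ∪ {universalUnitary h} ∪
        star (Set.range (universalRep h) ∪ {universalUnitary h})) : Set (ProductAlgebra h)) := by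
    rw [← StarAlgebra.adjoin_eq_span]; exact ha
  clear ha
  induction ha' using Submodule.span_induction generalizing n with
  | zero => exact continuous_const (y := (0 : ℂ))
  | add a b _ _ iha ihb => exact (iha n).add (ihb n)
  | smul c a _ iha => exact (iha n).const_smul c
  | mem a ha =>
    induction ha using Submonoid.closure_induction_left generalizing n with
    | one =>
      change Continuous fun x : X => (basisVec (0, x) : lp (fun _ : ℤ × X => ℂ) 2) (n, x)
      simp only [basisVec_zero_apply]
      exact continuous_const
    | mul_left g hg b _ ihb =>
      have key : ∀ f : C(X, ℂ), Continuous fun x : X =>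
          regularOp h (universalRep h f * b) (basisVec (0, x)) (n, x) := fun f =>
        (f.continuous.comp (h ^ n).continuous).mul (ihb n)
      rcases hg with (⟨f, rfl⟩ | rfl) | hg
      · exact key f
      · exact ihb (n + -1)
      · rcases hg with ⟨f, hf⟩ | hg
        · have : g = universalRep h (star f) := by rw [map_star, hf, star_star]
          rw [this]; exact key _
        · have : g = star (universalUnitary h) := by
            rw [← Set.mem_singleton_iff.1 hg, star_star]
          rw [this]
          have h2 : ∀ v m, regularOp h (star (universalUnitary h)) v m = v (m.1 + 1, m.2) := by
            intro v m
            change star (permOp ((Equiv.addRight (1 : ℤ)).prodCongr (Equiv.refl X))) v m = _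
            rw [star_permOp]; rfl
          refine (ihb (n + 1)).congr fun x => ?_
          exact (h2 (regularOp h b (basisVec (0, x))) (n, x)).symm

theorem norm_regularOp_apply_le [Nonempty X] (h : X ≃ₜ X) (a : ProductAlgebra h) (i j : ℤ × X) :
    ‖regularOp h a (basisVec i) j‖ ≤ ‖a‖ := by
  refine (lp.norm_apply_le_norm (by norm_num) _ j).trans ?_
  refine ((regularOp h a).le_opNorm _).trans ?_
  rw [norm_basisVec, mul_one]
  exact lp.norm_apply_le_norm ENNReal.top_ne_zero a (regularRep h)

theorem continuous_regular [Nonempty X] (h : X ≃ₜ X) (a : crossedProduct h) :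
    Continuous fun x : X => regularOp h a (basisVec (0, x)) (0, x) := by
  refine continuous_of_uniform_approx_of_continuous fun V hV => ?_
  obtain ⟨ε, hε, hV⟩ := Metric.mem_uniformity_dist.1 hV
  obtain ⟨b, hb, hab⟩ := Metric.mem_closure_iff.1 a.2 ε hε
  refine ⟨_, continuous_regular_of_mem_adjoin h b hb 0, fun x => hV ?_⟩
  rw [dist_eq_norm] at hab ⊢
  exact (norm_regularOp_apply_le h ((a : ProductAlgebra h) - b) (0, x) (0, x)).trans_lt hab

/-- The usual conditional expectation `E : C*(ℤ, X, h) → C(X)`: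
`E(a)(x) = ⟨a δ_{(0, x)}, δ_{(0, x)}⟩` in the regular representation. -/
def condExp [Nonempty X] (h : X ≃ₜ X) : crossedProduct h →L[ℂ] C(X, ℂ) :=
  LinearMap.mkContinuous
    { toFun := fun a => ⟨fun x => regularOp h a (basisVec (0, x)) (0, x), continuous_regular h a⟩
      map_add' := fun _ _ => rfl
      map_smul' := fun _ _ => rfl }
    1 fun a => by
      rw [one_mul]
      exact (ContinuousMap.norm_le _ (norm_nonneg _)).2 fun x =>
        norm_regularOp_apply_le h a (0, x) (0, x)

theorem regularOp_zpow [Nonempty X] (h : X ≃ₜ X) (n : ℤ) (v : lp (fun _ : ℤ × X => ℂ) 2)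
    (i : ℤ × X) :
    regularOp h ((stdUnitary h ^ n : unitary (crossedProduct h)) : crossedProduct h) v i =
      v (i.1 - n, i.2) := by
  have h1 : ∀ w i, regularOp h (universalUnitary h) w i = w (i.1 - 1, i.2) := fun _ _ => rfl
  have key : ∀ (m : ℕ) (v) (i : ℤ × X), regularOp h
      ((stdUnitary h ^ (m : ℤ) : unitary (crossedProduct h)) : crossedProduct h) v i =
      v (i.1 - m, i.2) := by
    intro m v
    induction m with
    | zero => intro i; simp; rfl
    | succ m ih =>
      intro i
      rw [Nat.cast_succ, add_comm, zpow_add, zpow_one]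
      refine (h1 _ _).trans ((ih _).trans ?_)
      have : i.1 - 1 - (m : ℤ) = i.1 - (1 + (m : ℤ)) := by ring
      simp only [this]
  obtain ⟨m, rfl | rfl⟩ := n.eq_nat_or_neg
  · exact key m v i
  · have h2 := key m (regularOp h
      ((stdUnitary h ^ (-(m : ℤ)) : unitary (crossedProduct h)) : crossedProduct h) v)
      (i.1 + m, i.2)
    have h3 : ((stdUnitary h ^ (m : ℤ) : unitary (crossedProduct h)) : crossedProduct h) *
        ((stdUnitary h ^ (-(m : ℤ)) : unitary (crossedProduct h)) : crossedProduct h) = 1 := by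
      rw [← Submonoid.coe_mul, ← zpow_add, add_neg_cancel, zpow_zero]; rfl
    have h4 : regularOp h
        ((stdUnitary h ^ (m : ℤ) : unitary (crossedProduct h)) : crossedProduct h) (regularOp h
        ((stdUnitary h ^ (-(m : ℤ)) : unitary (crossedProduct h)) : crossedProduct h) v) = v :=
      congrArg (fun b : crossedProduct h => regularOp h b v) h3
    rw [h4] at h2
    simp only [add_sub_cancel_right] at h2
    simpa using h2.symm

/-- `E(f uⁿ)` is `f` if `n = 0` and `0` otherwise. -/
theorem condExp_monomial [Nonempty X] (h : X ≃ₜ X) (f : C(X, ℂ)) (n : ℤ) :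
    condExp h (funIncl h f * ((stdUnitary h ^ n : unitary (crossedProduct h)) :
      crossedProduct h)) = if n = 0 then f else 0 := by
  ext x
  change f x * regularOp h ((stdUnitary h ^ n : unitary (crossedProduct h)) :
    crossedProduct h) (basisVec (0, x)) (0, x) = _
  rw [regularOp_zpow, basisVec_zero_apply]
  by_cases hn : n = 0 <;> simp [hn]

/-- The coefficient `a_n = E(a u⁻ⁿ)` of the formal series `∑ a_n uⁿ` of `a ∈ C*(ℤ, X, h)`. -/
def coeff [Nonempty X] (h : X ≃ₜ X) (n : ℤ) (a : crossedProduct h) : C(X, ℂ) :=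
  condExp h (a * ((stdUnitary h ^ (-n) : unitary (crossedProduct h)) : crossedProduct h))

/-! ### The orbit breaking subalgebra -/

/-- The `Y`-orbit breaking subalgebra `C*(ℤ, X, h)_Y = C*(C(X), C₀(X \ Y) u)`, where
`C₀(X \ Y)` consists of the `f ∈ C(X)` which vanish on `Y`. -/
def orbitBreaking (h : X ≃ₜ X) (Y : Set X) : StarSubalgebra ℂ (crossedProduct h) :=
  (StarAlgebra.adjoin ℂ (Set.range (funIncl h) ∪
    {a | ∃ f : C(X, ℂ), (∀ y ∈ Y, f y = 0) ∧
      a = funIncl h f * (stdUnitary h : crossedProduct h)})).topologicalClosure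

instance (h : X ≃ₜ X) (Y : Set X) :
    IsClosed (orbitBreaking h Y : Set (crossedProduct h)) :=
  StarSubalgebra.isClosed_topologicalClosure _

instance (h : X ≃ₜ X) (Y : Set X) : CStarAlgebra (orbitBreaking h Y) :=
  StarSubalgebra.cstarAlgebra _

/-- `f ∈ C(X)` as an element of `C*(ℤ, X, h)_Y`. -/
def orbitFun (h : X ≃ₜ X) (Y : Set X) (f : C(X, ℂ)) : orbitBreaking h Y :=
  ⟨funIncl h f, StarSubalgebra.le_topologicalClosure _
    (StarAlgebra.subset_adjoin ℂ _ (Or.inl ⟨f, rfl⟩))⟩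

/-- `f u` as an element of `C*(ℤ, X, h)_Y`, for `f ∈ C₀(X \ Y)`. -/
def orbitFunU (h : X ≃ₜ X) (Y : Set X) (f : C(X, ℂ)) (hf : ∀ y ∈ Y, f y = 0) :
    orbitBreaking h Y :=
  ⟨funIncl h f * (stdUnitary h : crossedProduct h), StarSubalgebra.le_topologicalClosure _
    (StarAlgebra.subset_adjoin ℂ _ (Or.inr ⟨f, hf, rfl⟩))⟩

/-! ### The matrices -/

/-- `diag (f|_Z, (f ∘ h)|_Z, …, (f ∘ h^(N-1))|_Z) ∈ M_N(C(Z))`. -/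
def towerDiag (h : X ≃ₜ X) (Z : Set X) (N : ℕ) (f : C(X, ℂ)) :
    CStarMatrix (Fin N) (Fin N) C(Z, ℂ) :=
  CStarMatrix.ofMatrix (Matrix.diagonal fun j : Fin N =>
    (f.comp ((h ^ (j : ℕ) : X ≃ₜ X) : C(X, X))).restrict Z)

/-- The matrix `w` with `1` in the positions `(j + 1, j)` and `0` elsewhere. -/
def shiftMatrix (Z : Set X) (N : ℕ) : CStarMatrix (Fin N) (Fin N) C(Z, ℂ) :=
  CStarMatrix.ofMatrix (Matrix.of fun j k : Fin N => if (j : ℕ) = (k : ℕ) + 1 then 1 else 0)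

/-- The conditions which determine the homomorphism `γ_{N, Z}`: on `C(X)` it is given by
`towerDiag`, and on `f u`, for `f ∈ C₀(X \ Y)`, by `towerDiag` times `w`. -/
def IsTowerHom (h : X ≃ₜ X) (Y Z : Set X) (N : ℕ)
    (γ : orbitBreaking h Y →⋆ₐ[ℂ] CStarMatrix (Fin N) (Fin N) C(Z, ℂ)) : Prop :=
  (∀ f : C(X, ℂ), γ (orbitFun h Y f) = towerDiag h Z N f) ∧
  ∀ (f : C(X, ℂ)) (hf : ∀ y ∈ Y, f y = 0),
    γ (orbitFunU h Y f hf) = towerDiag h Z N f * shiftMatrix Z N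

end OrbitBreaking

end

noncomputable section

namespace OrbitBreaking

universe u

variable {X : Type u}

/-! In the regular representation on `ℓ²(ℤ × X)`, the matrix coefficient of `a` from `δ_{(k, x)}` to
`δ_{(j, x)}` is `a_{j - k}(h^j(x))` (`coeff_apply`). So the required formula for `γ(a)(x)` says that
`γ(a)(x)` is the compression of `a` to the span of the tower `δ_{(0, x)}, …, δ_{(N - 1, x)}`, and
this serves as the definition. The entries are continuous in `x` because the `a_n` are continuous
functions.

A compression is multiplicative when its subspace is reducing, and this is where `Y` enters
(`supportProj_commute`). The operator `f u` moves a vector into the tower only at level `0`, with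
factor `f(x)`, and out of it only at level `N`, with factor `f(h^N(x))`. Both vanish if `f` vanishes
on `Y`, since `x ∈ Z ⊆ Y` and `h^N(x) ∈ Y`.

The sum formula is then read off entry by entry, and uniqueness follows from the continuity of
`*`-homomorphisms between C*-algebras. -/

/-! ### Basis vectors and coordinate projections of `ℓ²(ι)` -/

theorem permOp_basisVec {ι : Type u} (σ : Equiv.Perm ι) (i : ι) :
    permOp σ (basisVec i) = basisVec (σ i) := by
  ext j
  rw [permOp_apply]
  by_cases hj : j = σ i
  · subst hj
    rw [Equiv.symm_apply_apply, basisVec_self, basisVec_self]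
  · rw [basisVec_ne hj, basisVec_ne]
    rintro rfl
    exact hj (σ.apply_symm_apply j).symm

/-- The projection of `ℓ²(ι)` onto the vectors which are supported on `s`. -/
def supportProj {ι : Type u} (s : Set ι) : lp (fun _ : ι => ℂ) 2 →L[ℂ] lp (fun _ : ι => ℂ) 2 :=
  open Classical in
  -- The indicator of `s` is pulled back from a discrete two-point space, so every function on that
  -- space is continuous and boundedness and the adjoint come from `diagOp`.
  diagOp (X := ULift.{u} Bool) (fun i => ULift.up (decide (i ∈ s)))
    ⟨fun b => if b.down then 1 else 0, continuous_of_discreteTopology⟩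

theorem supportProj_apply_of_mem {ι : Type u} {s : Set ι} (v : lp (fun _ : ι => ℂ) 2) {i : ι}
    (hi : i ∈ s) : supportProj s v i = v i := by
  simp [supportProj, diagOp_apply, hi]

theorem supportProj_apply_of_notMem {ι : Type u} {s : Set ι} (v : lp (fun _ : ι => ℂ) 2) {i : ι}
    (hi : i ∉ s) : supportProj s v i = 0 := by
  simp [supportProj, diagOp_apply, hi]

theorem star_supportProj {ι : Type u} (s : Set ι) : star (supportProj s) = supportProj s := by
  unfold supportProj
  rw [star_diagOp]
  congr 1
  ext b
  simp only [ContinuousMap.star_apply, ContinuousMap.coe_mk]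
  split_ifs <;> simp

theorem supportProj_basisVec {ι : Type u} {s : Set ι} {i : ι} (hi : i ∈ s) :
    supportProj s (basisVec i) = basisVec i := by
  ext j
  by_cases hj : j ∈ s
  · rw [supportProj_apply_of_mem _ hj]
  · rw [supportProj_apply_of_notMem _ hj, basisVec_ne]
    rintro rfl
    exact hj hi

/-- The part of the orbit of `x` which forms the tower over `x` of height `N`. -/
def tower (N : ℕ) (x : X) : Set (ℤ × X) := {i | 0 ≤ i.1 ∧ i.1 < N ∧ i.2 = x}

/-- The tower has only `N` points, so a vector supported on it has a finite expansion. This turns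
operator products into matrix products. -/
theorem eq_sum_basisVec {N : ℕ} {x : X} (v : lp (fun _ : ℤ × X => ℂ) 2)
    (hv : supportProj (tower N x) v = v) :
    v = ∑ l : Fin N, v (((l : ℕ) : ℤ), x) • basisVec (((l : ℕ) : ℤ), x) := by
  ext i
  rw [lp.coeFn_sum, Finset.sum_apply]
  simp only [lp.coeFn_smul, Pi.smul_apply, smul_eq_mul]
  by_cases hi : i ∈ tower N x
  · obtain ⟨n, y⟩ := i
    obtain ⟨h0, h1, rfl⟩ := hi
    lift n to ℕ using h0
    simp only [Nat.cast_lt] at h1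
    rw [Finset.sum_eq_single (⟨n, h1⟩ : Fin N), basisVec_self, mul_one]
    · intro l _ hl
      rw [basisVec_ne, mul_zero]
      intro H
      apply hl
      ext
      have := congrArg Prod.fst H
      simp only at this ⊢
      omega
    · exact fun H => absurd (Finset.mem_univ _) H
  · rw [← hv, supportProj_apply_of_notMem _ hi, eq_comm]
    refine Finset.sum_eq_zero fun l _ => ?_
    rw [basisVec_ne, mul_zero]
    rintro rfl
    exact hi ⟨by simp, by simp, rfl⟩

theorem inner_basisVec {ι : Type u} (i : ι) (v : lp (fun _ : ι => ℂ) 2) :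
    inner ℂ (basisVec i) v = v i := by
  classical
  unfold basisVec
  rw [lp.inner_single_left]
  simp

variable [TopologicalSpace X]

/-! ### Entries of products with diagonal matrices and of powers of the shift -/

section Matrices

variable {h : X ≃ₜ X} {Z : Set X} {N : ℕ}

theorem ext_matrix {A B : CStarMatrix (Fin N) (Fin N) C(Z, ℂ)}
    (H : ∀ j k x, A j k x = B j k x) : A = B :=
  CStarMatrix.ext fun j k => ContinuousMap.ext (H j k)

theorem diagonal_mul_apply (f : C(X, ℂ)) (M : CStarMatrix (Fin N) (Fin N) C(Z, ℂ)) (j k : Fin N)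
    (x : Z) : (towerDiag h Z N f * M) j k x = f ((h ^ (j : ℕ)) x) * M j k x := by
  have : (towerDiag h Z N f * M) j k =
      (f.comp ((h ^ (j : ℕ) : X ≃ₜ X) : C(X, X))).restrict Z * M j k := by
    rw [CStarMatrix.mul_apply, Finset.sum_eq_single j]
    · congr 1
      exact Matrix.diagonal_apply_eq _ _
    · intro l _ hl
      have : towerDiag h Z N f j l = 0 := Matrix.diagonal_apply_ne _ hl.symm
      rw [this, zero_mul]
    · exact fun H => absurd (Finset.mem_univ _) H
  rw [this]
  rfl

theorem shiftMatrix_apply (j k : Fin N) :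
    shiftMatrix Z N j k = if (j : ℕ) = (k : ℕ) + 1 then 1 else 0 := rfl

theorem shiftMatrix_pow_apply (n : ℕ) (j k : Fin N) :
    (shiftMatrix Z N ^ n) j k = if (j : ℕ) = (k : ℕ) + n then 1 else 0 := by
  induction n generalizing k with
  | zero =>
    rw [pow_zero, CStarMatrix.one_apply, add_zero]
    exact if_congr Fin.ext_iff rfl rfl
  | succ n ih =>
    rw [pow_succ, CStarMatrix.mul_apply]
    simp only [ih, shiftMatrix_apply, ite_mul, one_mul, zero_mul]
    split_ifs with hjk
    · have hk : (k : ℕ) + 1 < N := by have := j.2; omega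
      rw [Finset.sum_eq_single (⟨k + 1, hk⟩ : Fin N)]
      · simp only [if_true]
        rw [if_pos (by omega)]
      · intro l _ hl
        rw [ne_eq, Fin.ext_iff] at hl
        simp only at hl
        rw [if_neg hl, ite_self]
      · exact fun H => absurd (Finset.mem_univ _) H
    · refine Finset.sum_eq_zero fun l _ => ?_
      split_ifs <;> first | rfl | omega

theorem star_shiftMatrix_pow_apply (n : ℕ) (j k : Fin N) :
    (star (shiftMatrix Z N) ^ n) j k = if (k : ℕ) = (j : ℕ) + n then 1 else 0 := by
  have : star (shiftMatrix Z N) ^ n = star (shiftMatrix Z N ^ n) := (star_pow _ n).symm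
  rw [this, CStarMatrix.star_apply, shiftMatrix_pow_apply]
  split_ifs <;> simp

end Matrices

/-! ### The regular representation and its matrix coefficients -/

/-- The covariant representation `ρ` as a homomorphism on the product algebra. -/
def evalHom {h : X ≃ₜ X} (ρ : CovariantRep h) : ProductAlgebra h →⋆ₐ[ℂ] (ρ.H →L[ℂ] ρ.H) where
  toFun a := a ρ
  map_one' := rfl
  map_mul' _ _ := rfl
  map_zero' := rfl
  map_add' _ _ := rfl
  commutes' _ := rfl
  map_star' _ := rfl

theorem continuous_evalHom {h : X ≃ₜ X} (ρ : CovariantRep h) : Continuous (evalHom ρ) :=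
  AddMonoidHomClass.continuous_of_bound (evalHom ρ) 1 fun a => by
    rw [one_mul]
    exact lp.norm_apply_le_norm ENNReal.top_ne_zero a ρ

variable [CompactSpace X]

/-- The regular representation of the crossed product. -/
def regularHom [Nonempty X] (h : X ≃ₜ X) :
    crossedProduct h →⋆ₐ[ℂ] (lp (fun _ : ℤ × X => ℂ) 2 →L[ℂ] lp (fun _ : ℤ × X => ℂ) 2) :=
  (evalHom (regularRep h)).comp (crossedProduct h).subtype

theorem continuous_regularHom [Nonempty X] (h : X ≃ₜ X) : Continuous (regularHom h) :=
  (continuous_evalHom _).comp continuous_subtype_val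

section Regular

variable [Nonempty X] (h : X ≃ₜ X)

theorem regularHom_funIncl (f : C(X, ℂ)) (v : lp (fun _ : ℤ × X => ℂ) 2) (i : ℤ × X) :
    regularHom h (funIncl h f) v i = f ((h ^ i.1) i.2) * v i := rfl

theorem regularHom_zpow (n : ℤ) (v : lp (fun _ : ℤ × X => ℂ) 2) (i : ℤ × X) :
    regularHom h ((stdUnitary h ^ n : unitary (crossedProduct h)) : crossedProduct h) v i =
      v (i.1 - n, i.2) := regularOp_zpow h n v i

theorem regularHom_zpow_basisVec (n m : ℤ) (x : X) :
    regularHom h ((stdUnitary h ^ n : unitary (crossedProduct h)) : crossedProduct h)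
      (basisVec (m, x)) = basisVec (m + n, x) := by
  ext i
  rw [regularHom_zpow]
  by_cases hi : i = (m + n, x)
  · subst hi
    simp [basisVec_self]
  · rw [basisVec_ne hi, basisVec_ne]
    intro H
    apply hi
    rw [Prod.ext_iff] at H ⊢
    exact ⟨by have := H.1; simp only at this ⊢; omega, H.2⟩

/-- This reduces commutation statements for a closed `*`-subalgebra to its generators. -/
theorem isClosed_comap_centralizer {A B : Type*} [CStarAlgebra A] [CStarAlgebra B]
    {φ : A →⋆ₐ[ℂ] B} (hφ : Continuous φ) (s : Set B) :
    IsClosed ((StarSubalgebra.centralizer ℂ s).comap φ : Set A) :=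
  (Set.isClosed_centralizer (s ∪ star s)).preimage hφ

/-- An operator which commutes, together with its adjoint, with `C(X)` and `u` commutes with the
image of the regular representation. -/
theorem regularHom_commute (T : lp (fun _ : ℤ × X => ℂ) 2 →L[ℂ] lp (fun _ : ℤ × X => ℂ) 2)
    (hf : ∀ f, T * regularHom h (funIncl h f) = regularHom h (funIncl h f) * T)
    (hu : T * regularHom h (stdUnitary h : crossedProduct h) =
      regularHom h (stdUnitary h : crossedProduct h) * T)
    (hu' : star T * regularHom h (stdUnitary h : crossedProduct h) =
      regularHom h (stdUnitary h : crossedProduct h) * star T)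
    (a : crossedProduct h) : T * regularHom h a = regularHom h a * T := by
  have key : crossedProduct h ≤
      (StarSubalgebra.centralizer ℂ {T}).comap (evalHom (regularRep h)) := by
    refine StarSubalgebra.topologicalClosure_minimal (StarAlgebra.adjoin_le ?_)
      (isClosed_comap_centralizer (continuous_evalHom _) _)
    rintro _ (⟨f, rfl⟩ | rfl)
    · refine (StarSubalgebra.mem_centralizer_iff ℂ).2 ?_
      -- The centralizer, as a `*`-subalgebra, requires commutation with `T` and with its adjoint.
      -- For `C(X)` the second is the adjoint of the first, applied to `star f`.
      have : star T * regularHom h (funIncl h f) = regularHom h (funIncl h f) * star T := by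
        refine star_injective ?_
        rw [star_mul, star_mul, star_star, ← map_star, ← map_star]
        exact (hf (star f)).symm
      rintro _ rfl
      exact ⟨hf f, this⟩
    · refine (StarSubalgebra.mem_centralizer_iff ℂ).2 ?_
      rintro _ rfl
      exact ⟨hu, hu'⟩
  exact ((StarSubalgebra.mem_centralizer_iff ℂ).1 (key a.2) T rfl).1

/-- The relabelling `(n, x) ↦ (n - m, h^m(x))` preserves the point `h^n(x)`, on which multiplication
by `f` depends, and commutes with the shift of the first coordinate. Its permutation operator
therefore commutes with the whole image of the crossed product. -/
theorem regularHom_translate (a : crossedProduct h) (j k m : ℤ) (x : X) :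
    regularHom h a (basisVec (k - m, (h ^ m) x)) (j - m, (h ^ m) x) =
      regularHom h a (basisVec (k, x)) (j, x) := by
  let σ : Equiv.Perm (ℤ × X) := (Equiv.subRight m).prodCongr (h ^ m).toEquiv
  have hσ : ∀ i, σ i = (i.1 - m, (h ^ m) i.2) := fun _ => rfl
  have hσ' : ∀ i, σ.symm i = (i.1 + m, (h ^ m).symm i.2) := fun _ => rfl
  have key : permOp σ * regularHom h a = regularHom h a * permOp σ := by
    refine regularHom_commute h (permOp σ) (fun f => ?_) ?_ ?_ a
    · ext v i
      change f ((h ^ (i.1 + m)) ((h ^ m).symm i.2)) * v (σ.symm i) =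
        f ((h ^ i.1) i.2) * v (σ.symm i)
      rw [zpow_add]
      change f ((h ^ i.1) ((h ^ m) ((h ^ m).symm i.2))) * _ = _
      rw [Homeomorph.apply_symm_apply]
    · ext v i
      change v (i.1 + m - 1, (h ^ m).symm i.2) = v (i.1 - 1 + m, (h ^ m).symm i.2)
      rw [add_sub_right_comm]
    · rw [star_permOp]
      ext v i
      change v (i.1 - m - 1, (h ^ m) i.2) = v (i.1 - 1 - m, (h ^ m) i.2)
      rw [sub_right_comm]
  have := congrArg (fun T : lp (fun _ : ℤ × X => ℂ) 2 →L[ℂ] lp (fun _ : ℤ × X => ℂ) 2 =>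
    T (basisVec (k, x)) (σ (j, x))) key
  simp only [mul_apply_eq_comp, permOp_basisVec, permOp_apply,
    Equiv.symm_apply_apply] at this
  exact this.symm

/-- Translation by `j` brings the target to level `0`, where `E` evaluates; the factor `u^{-(j -
k)}` sends `δ_{(0, h^j(x))}` to the translated source at level `k - j`. -/
theorem coeff_apply (a : crossedProduct h) (j k : ℤ) (x : X) :
    coeff h (j - k) a ((h ^ j) x) = regularHom h a (basisVec (k, x)) (j, x) := by
  rw [← regularHom_translate h a j k j x]
  change regularHom h (a * _) (basisVec (0, (h ^ j) x)) (0, (h ^ j) x) = _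
  rw [map_mul, mul_apply_eq_comp, regularHom_zpow_basisVec]
  simp

theorem coeff_funIncl (f : C(X, ℂ)) (n : ℤ) :
    coeff h n (funIncl h f) = if n = 0 then f else 0 := by
  rw [coeff, condExp_monomial]
  simp

theorem coeff_funIncl_mul_stdUnitary (f : C(X, ℂ)) (n : ℤ) :
    coeff h n (funIncl h f * (stdUnitary h : crossedProduct h)) = if n = 1 then f else 0 := by
  have : (stdUnitary h : crossedProduct h) *
      ((stdUnitary h ^ (-n) : unitary (crossedProduct h)) : crossedProduct h) =
      ((stdUnitary h ^ (1 - n) : unitary (crossedProduct h)) : crossedProduct h) := by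
    rw [← Submonoid.coe_mul, sub_eq_add_neg, zpow_add, zpow_one]
  rw [coeff, mul_assoc, this, condExp_monomial]
  simp [sub_eq_zero, eq_comm (a := n)]

/-! ### Towers reduce the orbit breaking subalgebra -/

variable {h} {Y : Set X}

/-- The vanishing of `f` on `Y` cuts the two links, below level `0` and above level `N - 1`, that
join the tower to the rest of the orbit. -/
theorem supportProj_commute {N : ℕ} {x : X} (hx : x ∈ Y) (hxN : (h ^ N) x ∈ Y)
    (a : orbitBreaking h Y) :
    supportProj (tower N x) * regularHom h a = regularHom h a * supportProj (tower N x) := by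
  have key : orbitBreaking h Y ≤
      (StarSubalgebra.centralizer ℂ {supportProj (tower N x)}).comap (regularHom h) := by
    refine StarSubalgebra.topologicalClosure_minimal (StarAlgebra.adjoin_le ?_)
      (isClosed_comap_centralizer (continuous_regularHom h) _)
    intro b hb
    refine (StarSubalgebra.mem_centralizer_iff ℂ).2 ?_
    rintro _ rfl
    rw [star_supportProj, and_self]
    rcases hb with ⟨f, rfl⟩ | ⟨f, hf, rfl⟩
    · ext v i
      rw [mul_apply_eq_comp, mul_apply_eq_comp]
      erw [regularHom_funIncl]
      by_cases hi : i ∈ tower N x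
      · rw [supportProj_apply_of_mem _ hi, supportProj_apply_of_mem _ hi]
        rfl
      · rw [supportProj_apply_of_notMem _ hi, supportProj_apply_of_notMem _ hi, mul_zero]
    · ext v ⟨n, y⟩
      have hreg : ∀ w : lp (fun _ : ℤ × X => ℂ) 2,
          regularHom h (funIncl h f * (stdUnitary h : crossedProduct h)) w (n, y) =
            f ((h ^ n) y) * w (n - 1, y) := fun _ => rfl
      rw [mul_apply_eq_comp, mul_apply_eq_comp]
      erw [hreg]
      by_cases hi : (n, y) ∈ tower N x <;> by_cases hi' : (n - 1, y) ∈ tower N x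
      · rw [supportProj_apply_of_mem _ hi, supportProj_apply_of_mem _ hi']
        exact hreg v
      · rw [supportProj_apply_of_mem _ hi, supportProj_apply_of_notMem _ hi', mul_zero]
        obtain ⟨h0, h1, rfl⟩ := hi
        -- The tower is entered from outside only at its bottom level, where the factor is `f(x)`.
        have hn : n = 0 := by
          by_contra hn
          exact hi' ⟨by simp only at *; omega, by simp only at *; omega, rfl⟩
        subst hn
        refine (hreg v).trans ?_
        have : f ((h ^ (0 : ℤ)) y) = 0 := hf _ hx
        rw [this, zero_mul]
      · rw [supportProj_apply_of_notMem _ hi]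
        obtain ⟨h0, h1, rfl⟩ := hi'
        -- The tower is left only from level `N - 1` to level `N`, where the factor is `f(h^N(x))`.
        have hn : n = N := by
          by_contra hn
          exact hi ⟨by simp only at *; omega, by simp only at *; omega, rfl⟩
        subst hn
        have : f ((h ^ (N : ℤ)) y) = 0 := by rw [zpow_natCast]; exact hf _ hxN
        rw [this, zero_mul]
      · rw [supportProj_apply_of_notMem _ hi, supportProj_apply_of_notMem _ hi', mul_zero]
  exact ((StarSubalgebra.mem_centralizer_iff ℂ).1 (key a.2) _ rfl).1

/-- Since the tower projection commutes with `b`, the vector `b δ_{(k, x)}` stays in the span of the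
tower, so the sum over intermediate basis vectors has only `N` terms. -/
theorem regularHom_mul_apply {N : ℕ} {x : X} (hx : x ∈ Y) (hxN : (h ^ N) x ∈ Y)
    (a b : orbitBreaking h Y) (j k : Fin N) :
    regularHom h ((a : crossedProduct h) * b) (basisVec (((k : ℕ) : ℤ), x)) (((j : ℕ) : ℤ), x) =
      ∑ l : Fin N, regularHom h a (basisVec (((l : ℕ) : ℤ), x)) (((j : ℕ) : ℤ), x) *
        regularHom h b (basisVec (((k : ℕ) : ℤ), x)) (((l : ℕ) : ℤ), x) := by
  have hb : supportProj (tower N x) (regularHom h b (basisVec (((k : ℕ) : ℤ), x))) =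
      regularHom h b (basisVec (((k : ℕ) : ℤ), x)) := by
    rw [← mul_apply_eq_comp, supportProj_commute hx hxN,
      mul_apply_eq_comp, supportProj_basisVec]
    exact ⟨by simp, by simp, rfl⟩
  rw [map_mul, mul_apply_eq_comp, eq_sum_basisVec _ hb, map_sum,
    lp.coeFn_sum, Finset.sum_apply]
  refine Finset.sum_congr rfl fun l _ => ?_
  rw [map_smul, lp.coeFn_smul, Pi.smul_apply, smul_eq_mul, mul_comm, ← eq_sum_basisVec _ hb]

theorem regularHom_star_apply (a : crossedProduct h) (i j : ℤ × X) :
    regularHom h (star a) (basisVec i) j = star (regularHom h a (basisVec j) i) := by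
  rw [map_star, ← inner_basisVec, ← inner_basisVec, ContinuousLinearMap.star_eq_adjoint,
    ContinuousLinearMap.adjoint_inner_right]
  exact (inner_conj_symm _ _).symm

end Regular

/-! ### Construction of the homomorphism and its formulas -/

/-- The matrix of the coefficients of `a` along the towers over the points of `Z`. -/
def towerMatrix [Nonempty X] (h : X ≃ₜ X) (Z : Set X) (N : ℕ) (a : crossedProduct h) :
    CStarMatrix (Fin N) (Fin N) C(Z, ℂ) :=
  CStarMatrix.ofMatrix (Matrix.of fun j k : Fin N =>
    ((coeff h ((j : ℤ) - (k : ℤ)) a).comp ((h ^ (j : ℕ) : X ≃ₜ X) : C(X, X))).restrict Z)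

section TowerHom

variable [Nonempty X] (h : X ≃ₜ X) (Y Z : Set X) (N : ℕ)

/-- Defining the entries by coefficient functions gives their continuity on `Z`; in this second form
the algebraic identities can be checked one point at a time. -/
theorem towerMatrix_apply (a : crossedProduct h) (j k : Fin N) (x : Z) :
    towerMatrix h Z N a j k x =
      regularHom h a (basisVec (((k : ℕ) : ℤ), (x : X))) (((j : ℕ) : ℤ), (x : X)) := by
  rw [← coeff_apply, zpow_natCast]
  rfl

theorem towerMatrix_one : towerMatrix h Z N 1 = 1 := by
  refine ext_matrix fun j k x => ?_
  rw [towerMatrix_apply, map_one, CStarMatrix.one_apply, one_apply_eq_self]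
  split_ifs with hjk
  · subst hjk
    exact basisVec_self _
  · refine basisVec_ne fun H => hjk ?_
    ext
    have := congrArg Prod.fst H
    simp only at this
    omega

variable {h Y Z N}

/-- The homomorphism `γ_{N, Z}`. -/
def towerHom (hZY : Z ⊆ Y) (hNZ : ∀ z ∈ Z, (h ^ N) z ∈ Y) :
    orbitBreaking h Y →⋆ₐ[ℂ] CStarMatrix (Fin N) (Fin N) C(Z, ℂ) where
  toFun a := towerMatrix h Z N a
  map_one' := towerMatrix_one h Z N
  map_mul' a b := ext_matrix fun j k x => by
    rw [towerMatrix_apply, CStarMatrix.mul_apply, ContinuousMap.sum_apply]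
    simp only [ContinuousMap.mul_apply, towerMatrix_apply]
    exact regularHom_mul_apply (hZY x.2) (hNZ x x.2) a b j k
  map_zero' := ext_matrix fun j k x => by
    rw [towerMatrix_apply]
    exact congrArg (fun T : lp (fun _ : ℤ × X => ℂ) 2 →L[ℂ] lp (fun _ : ℤ × X => ℂ) 2 =>
      T (basisVec (((k : ℕ) : ℤ), (x : X))) (((j : ℕ) : ℤ), (x : X))) (map_zero (regularHom h))
  map_add' a b := ext_matrix fun j k x => by
    rw [CStarMatrix.add_apply, ContinuousMap.add_apply]
    simp only [towerMatrix_apply]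
    rfl
  commutes' c := by
    rw [Algebra.algebraMap_eq_smul_one, Algebra.algebraMap_eq_smul_one, ← towerMatrix_one h Z N]
    refine ext_matrix fun j k x => ?_
    rw [CStarMatrix.smul_apply, ContinuousMap.smul_apply]
    simp only [towerMatrix_apply]
    rfl
  map_star' a := ext_matrix fun j k x => by
    rw [CStarMatrix.star_apply, ContinuousMap.star_apply]
    simp only [towerMatrix_apply]
    exact regularHom_star_apply (a : crossedProduct h) _ _

theorem towerHom_apply (hZY : Z ⊆ Y) (hNZ : ∀ z ∈ Z, (h ^ N) z ∈ Y) (a : orbitBreaking h Y)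
    (j k : Fin N) (x : Z) :
    towerHom hZY hNZ a j k x = coeff h ((j : ℤ) - (k : ℤ)) a ((h ^ (j : ℕ)) x) := rfl

/-- The formal series of `f` and of `f u` have a single term, in degree `0` and `1` respectively. -/
theorem isTowerHom_towerHom (hZY : Z ⊆ Y) (hNZ : ∀ z ∈ Z, (h ^ N) z ∈ Y) :
    IsTowerHom h Y Z N (towerHom hZY hNZ) := by
  refine ⟨fun f => ext_matrix fun j k x => ?_, fun f hf => ext_matrix fun j k x => ?_⟩
  · rw [towerHom_apply, ← mul_one (towerDiag h Z N f), diagonal_mul_apply, CStarMatrix.one_apply]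
    change coeff h _ (funIncl h f) _ = _
    rw [coeff_funIncl]
    by_cases hjk : j = k
    · subst hjk; simp
    · rw [if_neg hjk, if_neg (by rw [Fin.ext_iff] at hjk; omega)]
      simp
  · rw [towerHom_apply, diagonal_mul_apply, shiftMatrix_apply]
    change coeff h _ (funIncl h f * (stdUnitary h : crossedProduct h)) _ = _
    rw [coeff_funIncl_mul_stdUnitary]
    by_cases hjk : (j : ℕ) = k + 1
    · rw [if_pos hjk, if_pos (by omega)]
      simp
    · rw [if_neg hjk, if_neg (by omega)]
      simp

/-- The power `w^n` is supported on `j - k = n` and `(w*)^n` on `k - j = n`, so just one term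
contributes to each entry. Starting the second sum at `1` counts degree `0` once; the terms with `n
= N` vanish. -/
theorem towerHom_eq_sum (hZY : Z ⊆ Y) (hNZ : ∀ z ∈ Z, (h ^ N) z ∈ Y) (a : orbitBreaking h Y) :
    towerHom hZY hNZ a =
      ∑ n ∈ Finset.Icc 0 N,
        towerHom hZY hNZ (orbitFun h Y (coeff h (n : ℤ) a)) * shiftMatrix Z N ^ n +
      ∑ n ∈ Finset.Icc 1 N,
        towerHom hZY hNZ (orbitFun h Y (coeff h (-(n : ℤ)) a)) *
          star (shiftMatrix Z N) ^ n := by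
  have sum_apply : ∀ (s : Finset ℕ) (M : ℕ → CStarMatrix (Fin N) (Fin N) C(Z, ℂ)) (j k : Fin N)
      (x : Z), (∑ n ∈ s, M n) j k x = ∑ n ∈ s, M n j k x := by
    intro s M j k x
    induction s using Finset.cons_induction with
    | empty => rfl
    | cons n s hn ih =>
      rw [Finset.sum_cons, Finset.sum_cons, ← ih]
      rfl
  refine ext_matrix fun j k x => ?_
  rw [CStarMatrix.add_apply, ContinuousMap.add_apply, sum_apply, sum_apply]
  simp only [(isTowerHom_towerHom hZY hNZ).1, diagonal_mul_apply, shiftMatrix_pow_apply,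
    star_shiftMatrix_pow_apply]
  rw [towerHom_apply]
  rcases le_or_gt (k : ℕ) j with hkj | hkj
  · rw [Finset.sum_eq_single ((j : ℕ) - k), Finset.sum_eq_zero, if_pos (by omega)]
    · simp [Nat.cast_sub hkj]
    · intro n hn
      rw [Finset.mem_Icc] at hn
      rw [if_neg (by omega)]
      simp
    · intro n _ hn
      rw [if_neg (by omega)]
      simp
    · intro H
      exact absurd (Finset.mem_Icc.2 ⟨Nat.zero_le _, by omega⟩) H
  · rw [Finset.sum_eq_zero, Finset.sum_eq_single ((k : ℕ) - j), if_pos (by omega)]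
    · simp [Nat.cast_sub hkj.le]
    · intro n _ hn
      rw [if_neg (by omega)]
      simp
    · intro H
      exact absurd (Finset.mem_Icc.2 ⟨by omega, by omega⟩) H
    · intro n hn
      rw [if_neg (by omega)]
      simp

end TowerHom

/-! ### Uniqueness -/

-- Both homomorphisms are contractive, hence continuous, and they agree on generators of a dense
-- `*`-subalgebra.
open scoped ComplexOrder in
theorem IsTowerHom.eq [T2Space X] {h : X ≃ₜ X} {Y Z : Set X} (hZ : IsClosed Z) {N : ℕ}
    {γ γ' : orbitBreaking h Y →⋆ₐ[ℂ] CStarMatrix (Fin N) (Fin N) C(Z, ℂ)}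
    (hγ : IsTowerHom h Y Z N γ) (hγ' : IsTowerHom h Y Z N γ') : γ = γ' := by
  -- Compactness makes `C(Z)`, and so `M_N(C(Z))`, a C*-algebra, as the norm bound for `δ` requires.
  have : CompactSpace Z := isCompact_iff_compactSpace.1 hZ.isCompact
  have hc : ∀ δ : orbitBreaking h Y →⋆ₐ[ℂ] CStarMatrix (Fin N) (Fin N) C(Z, ℂ),
      Continuous δ := fun δ =>
    AddMonoidHomClass.continuous_of_bound δ 1 fun a => by
      rw [one_mul]
      exact NonUnitalStarAlgHom.norm_apply_le δ a
  refine StarAlgHom.ext_topologicalClosure (hc γ) (hc γ') ?_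
  refine StarAlgHom.ext_adjoin ?_
  rintro ⟨b, hb⟩ (⟨f, rfl⟩ | ⟨f, hf, rfl⟩)
  · exact (hγ.1 f).trans (hγ'.1 f).symm
  · exact (hγ.2 f hf).trans (hγ'.2 f hf).symm

end OrbitBreaking

end

theorem mainTheorem7 {X : Type*} [TopologicalSpace X] [CompactSpace X] [T2Space X] [Nonempty X]
    (h : X ≃ₜ X) (Y Z : Set X) (hY : IsClosed Y) (hZ : IsClosed Z) (hZne : Z.Nonempty)
    (hZY : Z ⊆ Y) (N : ℕ) (hN : 0 < N) (hNZ : ∀ z ∈ Z, (h ^ N) z ∈ Y) :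
    ∃ γ : OrbitBreaking.orbitBreaking h Y →⋆ₐ[ℂ] CStarMatrix (Fin N) (Fin N) C(Z, ℂ),
      OrbitBreaking.IsTowerHom h Y Z N γ ∧
      (∀ γ' : OrbitBreaking.orbitBreaking h Y →⋆ₐ[ℂ] CStarMatrix (Fin N) (Fin N) C(Z, ℂ),
        OrbitBreaking.IsTowerHom h Y Z N γ' → γ' = γ) ∧
      (∀ a : OrbitBreaking.orbitBreaking h Y,
        γ a =
          ∑ n ∈ Finset.Icc 0 N,
            γ (OrbitBreaking.orbitFun h Y (OrbitBreaking.coeff h (n : ℤ) a)) *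
              OrbitBreaking.shiftMatrix Z N ^ n +
          ∑ n ∈ Finset.Icc 1 N,
            γ (OrbitBreaking.orbitFun h Y (OrbitBreaking.coeff h (-(n : ℤ)) a)) *
              star (OrbitBreaking.shiftMatrix Z N) ^ n) ∧
      (∀ (a : OrbitBreaking.orbitBreaking h Y) (x : Z) (j k : Fin N),
        γ a j k x = OrbitBreaking.coeff h ((j : ℤ) - (k : ℤ)) a ((h ^ (j : ℕ)) x)) :=
  ⟨OrbitBreaking.towerHom hZY hNZ, OrbitBreaking.isTowerHom_towerHom hZY hNZ,
    fun _ hγ' => hγ'.eq hZ (OrbitBreaking.isTowerHom_towerHom hZY hNZ),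
    OrbitBreaking.towerHom_eq_sum hZY hNZ, fun a x j k =>
      OrbitBreaking.towerHom_apply hZY hNZ a j k x⟩
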